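/- Let $X$ be a complex manifold (Hausdorff, with countable topology, of pure finite dimension), and let $\pi\colon\mathbb{P}TX\to X$ be its projectivized holomorphic tangent bundle. For a continuous plurisubharmonic function $\varphi\colon X\to\mathbb{R}$ let $$C(\varphi):=\mathbb{P}TX\setminus\bigl\{[v]\in\mathbb{P}TX : \varphi \text{ is smooth in a neighbourhood of } \pi[v] \text{ and } \partial\varphi(v)\neq 0\bigr\},$$ and let $C(X):=\bigcap_{\varphi}C(\varphi)$, where $\varphi$ runs over all continuous plurisubharmonic functions $X\to\mathbb{R}$. Put $\Omega:=X\setminus\pi(C(X))$. Then there exists a continuous plurisubharmonic function $\psi\colon X\to\mathbb{R}$ which is strictly plurisubharmonic on $\Omega$, in the following sense: every point of $\Omega$ has an open neighbourhood $U\subseteq\Omega$ on which $\psi$ is the sum of a continuous plurisubharmonic function and a smooth strictly plurisubharmonic function (a smooth function whose Levi form is positive definite at every point of $U$). In particular, $\Omega$ is open. -/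

import Mathlib

open scoped Manifold ContDiff LinearAlgebra.Projectivization

noncomputable section

namespace ComplexMfd

section Local

variable {E : Type*} [NormedAddCommGroup E] [NormedSpace ℂ E]

/-- `f` is continuous and plurisubharmonic on the (open) set `V` of the complex vector space `E`:
it is continuous, and satisfies the sub-mean value inequality on every closed disc
`{a + ζ b : |ζ| ≤ 1}` of a complex line that lies in `V`. -/
def IsContPshOn (f : E → ℝ) (V : Set E) : Prop :=
  ContinuousOn f V ∧
    ∀ a b : E, (∀ ζ : ℂ, ‖ζ‖ ≤ 1 → a + ζ • b ∈ V) →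
      f a ≤ Real.circleAverage (fun ζ : ℂ => f (a + ζ • b)) 0 1

/-- The Levi form of a real `C²` function at `z` in the direction `v`, that is
`∑ (∂²f / ∂z_j ∂z̄_k) v_j v̄_k = (D²f(v, v) + D²f(iv, iv)) / 4`. -/
def leviForm (f : E → ℝ) (z v : E) : ℝ :=
  (fderiv ℝ (fderiv ℝ f) z v v
    + fderiv ℝ (fderiv ℝ f) z (Complex.I • v) (Complex.I • v)) / 4

/-- The `(1,0)`-part of a real linear form `d`: the complex linear form
`v ↦ (d(v) - i d(iv)) / 2`. -/
def oneZeroPart (d : E →L[ℝ] ℝ) : E →ₗ[ℂ] ℂ where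
  toFun v := ((d v : ℂ) - Complex.I * (d (Complex.I • v) : ℂ)) / 2
  map_add' v w := by
    simp only [smul_add, map_add, Complex.ofReal_add]
    ring
  map_smul' c v := by
    have key : ∀ (a b : ℝ) (w : E), d ((a + b * Complex.I : ℂ) • w)
        = a * d w + b * d (Complex.I • w) := fun a b w => by
      rw [add_smul, mul_smul, Complex.coe_smul, Complex.coe_smul, map_add, map_smul, map_smul]
      rfl
    have h1 : d (c • v) = c.re * d v + c.im * d (Complex.I • v) := by
      rw [← key, Complex.re_add_im]
    have h2 : d (Complex.I • c • v) = -c.im * d v + c.re * d (Complex.I • v) := by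
      rw [← key, smul_smul]
      congr 2
      apply Complex.ext <;> simp
    rw [h1, h2]
    apply Complex.ext <;> simp <;> ring

end Local

section Manifold

variable (E : Type*) [NormedAddCommGroup E] [NormedSpace ℂ E]
  {X : Type*} [TopologicalSpace X] [ChartedSpace E X]

/-- `φ` is continuous and plurisubharmonic on the open set `U` of the complex manifold `X`:
it is continuous on `U`, and plurisubharmonic in every holomorphic chart. -/
def ContPshOn (φ : X → ℝ) (U : Set X) : Prop :=
  ContinuousOn φ U ∧
    ∀ e ∈ IsManifold.maximalAtlas 𝓘(ℂ, E) ω X,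
      IsContPshOn (φ ∘ e.symm) (e.target ∩ e.symm ⁻¹' U)

/-- `φ` is smooth (real `C^∞`) on the open set `U` of `X`. -/
def SmoothOn (φ : X → ℝ) (U : Set X) : Prop :=
  ContMDiffOn 𝓘(ℝ, E) 𝓘(ℝ, ℝ) ∞ φ U

/-- `φ` is smooth and strictly plurisubharmonic on the open set `U` of `X`: it is smooth on `U`,
and its Levi form is positive definite at every point of `U`, in every holomorphic chart. -/
def SmoothStrictPshOn (φ : X → ℝ) (U : Set X) : Prop :=
  SmoothOn E φ U ∧
    ∀ e ∈ IsManifold.maximalAtlas 𝓘(ℂ, E) ω X, ∀ z ∈ e.target ∩ e.symm ⁻¹' U,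
      ∀ v : E, v ≠ 0 → 0 < leviForm (φ ∘ e.symm) z v

/-- `φ` is strictly plurisubharmonic on `Ω`, for a continuous `φ`: every point of `Ω` has an open
neighbourhood `U` inside `Ω` on which `φ` is the sum of a continuous plurisubharmonic function and
a smooth strictly plurisubharmonic one. (In particular `Ω` is open.) -/
def StrictPshOn (φ : X → ℝ) (Ω : Set X) : Prop :=
  ContinuousOn φ Ω ∧
    ∀ x ∈ Ω, ∃ U : Set X, IsOpen U ∧ x ∈ U ∧ U ⊆ Ω ∧
      ∃ u s : X → ℝ, ContPshOn E u U ∧ SmoothStrictPshOn E s U ∧ ∀ y ∈ U, φ y = u y + s y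

/-- The `(1,0)`-part `∂φ` of the differential of `φ` at `x`, as a complex linear form on the
holomorphic tangent space. The real tangent space at `x` is the holomorphic tangent space with
scalars restricted to `ℝ` (both are read in the preferred chart at `x`). -/
def del (φ : X → ℝ) (x : X) : TangentSpace 𝓘(ℂ, E) x →ₗ[ℂ] ℂ :=
  oneZeroPart (E := E) (mfderiv 𝓘(ℝ, E) 𝓘(ℝ, ℝ) φ x)

variable (X)

/-- The projectivized holomorphic tangent bundle `ℙTX`: pairs of a point `x` and a complex line
in the holomorphic tangent space at `x`. -/
abbrev PTangent : Type _ := Σ x : X, ℙ ℂ (TangentSpace 𝓘(ℂ, E) x)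

/-- The projection `π : ℙTX → X`. -/
def proj : PTangent E X → X := Sigma.fst

variable {X}

/-- The set `C(φ)`: the complement in `ℙTX` of the set of those `[v]` such that `φ` is smooth
around `π[v]` and `∂φ(v) ≠ 0`. As `∂φ` is complex linear, the choice of `v` does not matter. -/
def critSet (φ : X → ℝ) : Set (PTangent E X) :=
  {p | (∃ U : Set X, IsOpen U ∧ proj E X p ∈ U ∧ SmoothOn E φ U) ∧
    del E φ p.1 p.2.rep ≠ 0}ᶜ

variable (X)

/-- The set `C(X)`: the intersection of the sets `C(φ)` over all continuous plurisubharmonic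
functions `φ` on `X`. -/
def critCore : Set (PTangent E X) :=
  ⋂ (φ : X → ℝ) (_ : ContPshOn E φ Set.univ), critSet E φ

end Manifold

end ComplexMfd

end

/-! The Levi form of `exp φ` is `exp φ` times the Levi form of `φ` plus `|∂φ|²` (`leviForm_exp`).
Where a plurisubharmonic `φ` is smooth, its Levi form is nonnegative
(`IsContPshOn.leviForm_nonneg`), so `exp φ` is strictly plurisubharmonic in every direction on which
`∂φ` does not vanish. Over a point of `Ω` each direction is detected by some global `φ`. Compactness
of the unit sphere and continuity of `∂φ` leave finitely many `φ` that detect all directions over a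
whole neighbourhood `U` (`exists_finset_del_ne_zero`). Hence `U ⊆ Ω`, and the sum of their
exponentials is plurisubharmonic on `X` and smooth strictly plurisubharmonic on `U`.

Countably many such `U` cover `Ω`. The corresponding functions, with weights small on a compact
exhaustion, sum to a continuous plurisubharmonic `ψ` (`contPshOn_tsum`). On the `k`-th set, the
`k`-th term is the smooth strict summand and the rest of the series is the plurisubharmonic one; `ψ`
itself need not be smooth there. -/

namespace ComplexMfd

/-! ### Levi forms and plurisubharmonic functions on a complex vector space. -/

section Local

variable {E : Type*} [NormedAddCommGroup E] [NormedSpace ℂ E]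

open Filter Topology in
/-- Second order Taylor expansion with Peano remainder at a point. -/
theorem taylor_two_isLittleO {F : Type*} [NormedAddCommGroup F] [NormedSpace ℝ F] {f : F → ℝ}
    {z : F} (hf : ContDiffAt ℝ 2 f z) :
    (fun h : F => f (z + h) - f z - fderiv ℝ f z h - fderiv ℝ (fderiv ℝ f) z h h / 2)
      =o[𝓝 0] fun h => ‖h‖ ^ 2 := by
  set B := fderiv ℝ (fderiv ℝ f) z with hB
  have hsymm : ∀ v w, B v w = B w v := fun v w =>
    (hf.isSymmSndFDerivAt (by simp)).eq v w
  have hdf : HasFDerivAt (fderiv ℝ f) B z :=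
    ((hf.fderiv_right (m := 1) (by norm_num)).differentiableAt (by norm_num)).hasFDerivAt
  have hdiff : ∀ᶠ h in 𝓝 (0 : F), DifferentiableAt ℝ f (z + h) := by
    have h1 : ∀ᶠ y in 𝓝 z, DifferentiableAt ℝ f y :=
      (hf.eventually (by simp)).mono fun y hy => hy.differentiableAt (by norm_num)
    have h2 : Tendsto (fun h : F => z + h) (𝓝 0) (𝓝 z) := by
      simpa using (continuous_const_add z).tendsto 0
    exact h2.eventually h1
  rw [Asymptotics.isLittleO_iff]
  intro c hc
  have hlit := (Asymptotics.isLittleO_iff.1 (hasFDerivAt_iff_isLittleO_nhds_zero.1 hdf)) hc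
  obtain ⟨r, hr, hball⟩ := Metric.eventually_nhds_iff_ball.1 (hdiff.and hlit)
  filter_upwards [Metric.ball_mem_nhds (0 : F) hr] with h hh
  have hsub : Metric.closedBall (0 : F) ‖h‖ ⊆ Metric.ball 0 r :=
    Metric.closedBall_subset_ball (by simpa using hh)
  -- By symmetry of `B`, the remainder has derivative `Df(z + k) - Df(z) - B k`. This is at most `c
  -- * ‖k‖` because `Df` is differentiable at `z`, and the mean value inequality on the ball of
  -- radius `‖h‖` gives the second factor `‖h‖`.
  have hder : ∀ k ∈ Metric.closedBall (0 : F) ‖h‖, HasFDerivWithinAt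
      (fun h : F => f (z + h) - f z - fderiv ℝ f z h - B h h / 2)
      (fderiv ℝ f (z + k) - fderiv ℝ f z - B k) (Metric.closedBall (0 : F) ‖h‖) k := by
    intro k hk
    have h1 : HasFDerivAt (fun h : F => f (z + h)) (fderiv ℝ f (z + k)) k :=
      (hasFDerivAt_comp_add_left z).2 (hball k (hsub hk)).1.hasFDerivAt
    have h2 : HasFDerivAt (fun h : F => B h h) (B k + B.flip k) k :=
      B.hasFDerivAt.clm_apply (hasFDerivAt_id k)
    have h3 := ((h1.sub_const (f z)).sub (fderiv ℝ f z).hasFDerivAt).sub (h2.mul_const (1 / 2))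
    have h4 : fderiv ℝ f (z + k) - fderiv ℝ f z - B k
        = fderiv ℝ f (z + k) - fderiv ℝ f z - (1 / 2 : ℝ) • (B k + B.flip k) := by
      ext w
      simp [hsymm w k]
      ring
    rw [h4]
    refine (h3.congr_of_eventuallyEq (Eventually.of_forall fun w => ?_)).hasFDerivWithinAt
    simp
    ring
  have := (convex_closedBall (0 : F) ‖h‖).norm_image_sub_le_of_norm_hasFDerivWithin_le
    (C := c * ‖h‖) hder (fun k hk => ?_) (x := 0) (y := h) (by simp) (by simp)
  · simpa [pow_two, mul_assoc] using this
  · refine (hball k (hsub hk)).2.trans ?_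
    gcongr
    simpa using hk

theorem circleMap_smul_eq (v : E) (θ : ℝ) :
    circleMap 0 1 θ • v = Real.cos θ • v + Real.sin θ • (Complex.I • v) := by
  have : circleMap 0 1 θ = (Real.cos θ : ℂ) + (Real.sin θ : ℂ) * Complex.I := by
    simp [circleMap, Complex.exp_mul_I]
  rw [this, add_smul, mul_smul, Complex.coe_smul, Complex.coe_smul]

/-- The circle average of a real polynomial of degree two without constant term. -/
theorem circleAverage_linear_add_quadratic (d : E →L[ℝ] ℝ) (B : E →L[ℝ] E →L[ℝ] ℝ) (v : E) :
    Real.circleAverage (fun ζ : ℂ => d (ζ • v) + B (ζ • v) (ζ • v) / 2) 0 1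
      = (B v v + B (Complex.I • v) (Complex.I • v)) / 4 := by
  -- Over the circle, `cos²` and `sin²` average to `1/2`, while `cos`, `sin` and `sin * cos` average
  -- to zero.
  have key : ∀ θ : ℝ, d (circleMap 0 1 θ • v)
      + B (circleMap 0 1 θ • v) (circleMap 0 1 θ • v) / 2
      = (Real.cos θ * d v + Real.sin θ * d (Complex.I • v))
        + (Real.cos θ ^ 2 * (B v v / 2) + Real.sin θ ^ 2 * (B (Complex.I • v) (Complex.I • v) / 2))
        + Real.sin θ * Real.cos θ * ((B v (Complex.I • v) + B (Complex.I • v) v) / 2) := by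
    intro θ
    rw [circleMap_smul_eq]
    simp only [map_add, map_smul, add_apply, smul_apply, smul_eq_mul]
    ring
  rw [Real.circleAverage_def]
  simp_rw [key]
  have hi : ∀ g : ℝ → ℝ, Continuous g →
      IntervalIntegrable g MeasureTheory.volume 0 (2 * Real.pi) :=
    fun g hg => hg.intervalIntegrable _ _
  rw [intervalIntegral.integral_add (hi _ (by fun_prop)) (hi _ (by fun_prop)),
    intervalIntegral.integral_add (hi _ (by fun_prop)) (hi _ (by fun_prop)),
    intervalIntegral.integral_add (hi _ (by fun_prop)) (hi _ (by fun_prop)),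
    intervalIntegral.integral_add (hi _ (by fun_prop)) (hi _ (by fun_prop))]
  simp only [intervalIntegral.integral_mul_const, integral_cos, integral_sin, integral_cos_sq,
    integral_sin_sq, integral_sin_mul_cos₁]
  simp
  field_simp
  ring

open Filter Topology in
/-- The Levi form of a plurisubharmonic function is nonnegative wherever the function is `C²`. -/
theorem IsContPshOn.leviForm_nonneg {f : E → ℝ} {V : Set E} (hf : IsContPshOn f V)
    (hV : IsOpen V) {z : E} (hz : z ∈ V) (hs : ContDiffAt ℝ 2 f z) (v : E) :
    0 ≤ leviForm f z v := by
  refine le_of_forall_pos_le_add fun ε hε => ?_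
  set d := fderiv ℝ f z
  set B := fderiv ℝ (fderiv ℝ f) z
  -- The Peano constant is chosen so that the error is at most `ε` in the direction `v`; the `+ 1`
  -- covers `v = 0`.
  set c : ℝ := ε / (‖v‖ ^ 2 + 1) with hc
  have hcpos : 0 < c := by positivity
  have hcv : c * ‖v‖ ^ 2 ≤ ε := by
    rw [hc, div_mul_eq_mul_div, div_le_iff₀ (by positivity)]
    nlinarith
  have h1 := Asymptotics.isLittleO_iff.1 (taylor_two_isLittleO hs) hcpos
  have h2 : ∀ᶠ h in 𝓝 (0 : E), z + h ∈ V := by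
    have : Tendsto (fun h : E => z + h) (𝓝 0) (𝓝 z) := by
      simpa using (continuous_const_add z).tendsto 0
    exact this.eventually (hV.mem_nhds hz)
  obtain ⟨r, hr, hball⟩ := Metric.eventually_nhds_iff_ball.1 (h1.and h2)
  set t : ℝ := r / (2 * (‖v‖ + 1)) with ht
  have htpos : 0 < t := by positivity
  have hmem : ∀ ζ : ℂ, ‖ζ‖ ≤ 1 → ζ • (t • v) ∈ Metric.ball (0 : E) r := by
    intro ζ hζ
    rw [mem_ball_zero_iff, norm_smul, norm_smul, Real.norm_of_nonneg htpos.le]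
    calc ‖ζ‖ * (t * ‖v‖) ≤ 1 * (t * ‖v‖) := by gcongr
      _ < t * (2 * (‖v‖ + 1)) := by nlinarith [norm_nonneg v]
      _ = r := by rw [ht]; field_simp
  have hmean := hf.2 z (t • v) fun ζ hζ => (hball _ (hmem ζ hζ)).2
  have hcont : CircleIntegrable (fun ζ : ℂ => f (z + ζ • (t • v))) 0 1 := by
    refine ContinuousOn.circleIntegrable (by norm_num) ?_
    refine hf.1.comp (by fun_prop) fun ζ hζ => (hball _ (hmem ζ ?_)).2
    simpa using (mem_sphere_zero_iff_norm.1 hζ).le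
  have hquad : CircleIntegrable
      (fun ζ : ℂ => d (ζ • (t • v)) + B (ζ • (t • v)) (ζ • (t • v)) / 2) 0 1 := by
    refine ContinuousOn.circleIntegrable (by norm_num) ?_
    fun_prop
  have hle : Real.circleAverage (fun ζ : ℂ => f (z + ζ • (t • v))) 0 1
      ≤ Real.circleAverage (fun ζ : ℂ => (d (ζ • (t • v)) + B (ζ • (t • v)) (ζ • (t • v)) / 2)
        + (f z + c * ‖t • v‖ ^ 2)) 0 1 := by
    refine Real.circleAverage_mono hcont
      (hquad.add (circleIntegrable_const _ _ _)) fun ζ hζ => ?_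
    have hζ1 : ‖ζ‖ = 1 := by simpa using hζ
    have := (abs_le.1 ((hball _ (hmem ζ hζ1.le)).1)).2
    rw [norm_smul ζ, hζ1, one_mul, norm_pow, norm_norm] at this
    linarith
  have havg := Real.circleAverage_add hquad (circleIntegrable_const (f z + c * ‖t • v‖ ^ 2) 0 1)
  have havg' : Real.circleAverage (fun ζ : ℂ => (d (ζ • (t • v))
      + B (ζ • (t • v)) (ζ • (t • v)) / 2) + (f z + c * ‖t • v‖ ^ 2)) 0 1
      = t ^ 2 * leviForm f z v + (f z + c * ‖t • v‖ ^ 2) := by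
    refine havg.trans ?_
    rw [circleAverage_linear_add_quadratic, Real.circleAverage_const]
    have : Complex.I • t • v = t • Complex.I • v := smul_comm _ _ _
    simp only [this, map_smul, smul_apply, smul_eq_mul, leviForm]
    ring
  rw [havg'] at hle
  rw [norm_smul, Real.norm_of_nonneg htpos.le] at hle
  -- The value `f z` cancels from the sub-mean inequality, and every remaining term carries the
  -- factor `t ^ 2`.
  have : 0 ≤ t ^ 2 * (leviForm f z v + c * ‖v‖ ^ 2) := by linarith
  have := nonneg_of_mul_nonneg_right this (by positivity : 0 < t ^ 2)
  linarith

theorem oneZeroPart_eq_zero_iff (d : E →L[ℝ] ℝ) (v : E) :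
    oneZeroPart d v = 0 ↔ d v = 0 ∧ d (Complex.I • v) = 0 := by
  simp [oneZeroPart, Complex.ext_iff]

open Filter Topology in
/-- The Levi form of `exp ∘ f` is `exp f` times that of `f` plus `|∂f|²`. -/
theorem leviForm_exp {f : E → ℝ} {z : E} (hf : ContDiffAt ℝ 2 f z) (v : E) :
    leviForm (fun y => Real.exp (f y)) z v = Real.exp (f z) *
      (leviForm f z v + ((fderiv ℝ f z v) ^ 2 + (fderiv ℝ f z (Complex.I • v)) ^ 2) / 4) := by
  have h1 : fderiv ℝ (fun y => Real.exp (f y)) =ᶠ[𝓝 z] fun y => Real.exp (f y) • fderiv ℝ f y :=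
    (hf.eventually (by simp)).mono fun y hy =>
      fderiv_exp (hy.differentiableAt (by norm_num))
  have h2 : HasFDerivAt (fderiv ℝ f) (fderiv ℝ (fderiv ℝ f) z) z :=
    ((hf.fderiv_right (m := 1) (by norm_num)).differentiableAt (by norm_num)).hasFDerivAt
  have h3 := ((hf.differentiableAt (by norm_num)).hasFDerivAt.exp.smul h2).fderiv
  have h4 : fderiv ℝ (fun y => Real.exp (f y) • fderiv ℝ f y) z = _ := h3
  simp only [leviForm, h1.fderiv_eq, h4]
  simp
  ring

open Filter Topology in
theorem leviForm_add {f g : E → ℝ} {z : E} (hf : ContDiffAt ℝ 2 f z) (hg : ContDiffAt ℝ 2 g z)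
    (v : E) : leviForm (fun y => f y + g y) z v = leviForm f z v + leviForm g z v := by
  have h1 : fderiv ℝ (fun y => f y + g y) =ᶠ[𝓝 z] fun y => fderiv ℝ f y + fderiv ℝ g y :=
    ((hf.eventually (by simp)).and (hg.eventually (by simp))).mono fun y hy =>
      fderiv_fun_add (hy.1.differentiableAt (by norm_num)) (hy.2.differentiableAt (by norm_num))
  have h2 : ∀ {f : E → ℝ}, ContDiffAt ℝ 2 f z → DifferentiableAt ℝ (fderiv ℝ f) z := fun hf =>
    (hf.fderiv_right (m := 1) (by norm_num)).differentiableAt (by norm_num)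
  simp only [leviForm, h1.fderiv_eq, fderiv_fun_add (h2 hf) (h2 hg)]
  simp
  ring

theorem leviForm_const (c : ℝ) (z v : E) : leviForm (fun _ : E => c) z v = 0 := by
  simp [leviForm]

theorem leviForm_sum {ι : Type*} {s : Finset ι} {f : ι → E → ℝ} {z : E}
    (hf : ∀ i ∈ s, ContDiffAt ℝ 2 (f i) z) (v : E) :
    leviForm (fun y => ∑ i ∈ s, f i y) z v = ∑ i ∈ s, leviForm (f i) z v := by
  classical
  induction s using Finset.induction_on with
  | empty => simp [leviForm_const]
  | insert a s ha ih =>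
    simp only [Finset.sum_insert ha]
    rw [leviForm_add (hf a (Finset.mem_insert_self a s)), ih]
    · exact fun i hi => hf i (Finset.mem_insert_of_mem hi)
    · exact ContDiffAt.sum fun i hi => hf i (Finset.mem_insert_of_mem hi)

/-- No regularity is needed: multiplication by a real constant commutes with `fderiv` even where the
function is not differentiable. -/
theorem leviForm_const_mul {f : E → ℝ} (c : ℝ) (z v : E) :
    leviForm (fun y => c * f y) z v = c * leviForm f z v := by
  have h1 : fderiv ℝ (fun y => c * f y) = fun y => c • fderiv ℝ f y := by
    funext y
    exact congrFun (fderiv_const_smul_field (𝕜 := ℝ) (f := f) c) y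
  have h2 : fderiv ℝ (fun y => c • fderiv ℝ f y) z = c • fderiv ℝ (fderiv ℝ f) z :=
    congrFun (fderiv_const_smul_field (𝕜 := ℝ) (f := fderiv ℝ f) c) z
  simp only [leviForm, h1, h2]
  simp
  ring

/-! ### Closure properties of plurisubharmonic functions. -/

theorem IsContPshOn.mono {f : E → ℝ} {V W : Set E} (hf : IsContPshOn f V) (h : W ⊆ V) :
    IsContPshOn f W :=
  ⟨hf.1.mono h, fun a b hab => hf.2 a b fun ζ hζ => h (hab ζ hζ)⟩

theorem circleIntegrable_disc {f : E → ℝ} {V : Set E} (hf : ContinuousOn f V) {a b : E}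
    (h : ∀ ζ : ℂ, ‖ζ‖ ≤ 1 → a + ζ • b ∈ V) :
    CircleIntegrable (fun ζ : ℂ => f (a + ζ • b)) 0 1 := by
  refine ContinuousOn.circleIntegrable (by norm_num) ?_
  refine hf.comp (by fun_prop) fun ζ hζ => h ζ ?_
  simpa using (mem_sphere_zero_iff_norm.1 hζ).le

theorem isContPshOn_const (c : ℝ) (V : Set E) : IsContPshOn (fun _ => c) V :=
  ⟨continuousOn_const, fun a b _ => by simp [Real.circleAverage_const]⟩

theorem IsContPshOn.add {f g : E → ℝ} {V : Set E} (hf : IsContPshOn f V)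
    (hg : IsContPshOn g V) : IsContPshOn (fun y => f y + g y) V :=
  ⟨hf.1.add hg.1, fun a b h => (add_le_add (hf.2 a b h) (hg.2 a b h)).trans
    (Real.circleAverage_add (circleIntegrable_disc hf.1 h) (circleIntegrable_disc hg.1 h)).ge⟩

theorem IsContPshOn.const_mul {f : E → ℝ} {V : Set E} {c : ℝ} (hc : 0 ≤ c)
    (hf : IsContPshOn f V) : IsContPshOn (fun y => c * f y) V :=
  ⟨continuousOn_const.mul hf.1, fun a b h => (mul_le_mul_of_nonneg_left (hf.2 a b h) hc).trans
    (Real.circleAverage_fun_smul (a := c)).ge⟩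

/-- The exponential of a continuous plurisubharmonic function is plurisubharmonic: with
`m` the value at the centre, `exp t ≥ exp m * (1 + t - m)`. -/
theorem IsContPshOn.exp {f : E → ℝ} {V : Set E} (hf : IsContPshOn f V) :
    IsContPshOn (fun y => Real.exp (f y)) V := by
  refine ⟨hf.1.rexp, fun a b h => ?_⟩
  have hi := circleIntegrable_disc hf.1 h
  have hg : IsContPshOn (fun y => Real.exp (f a) * (f y + (1 - f a))) V :=
    (hf.add (isContPshOn_const _ _)).const_mul (Real.exp_pos _).le
  have h1 := hg.2 a b h
  have h2 := Real.circleAverage_mono (circleIntegrable_disc hg.1 h)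
    (circleIntegrable_disc hf.1.rexp h) fun ζ _ => ?_
  · refine le_trans ?_ (h1.trans h2)
    simp
  · have h3 := Real.add_one_le_exp (f (a + ζ • b) - f a)
    have h4 : Real.exp (f (a + ζ • b))
        = Real.exp (f a) * Real.exp (f (a + ζ • b) - f a) := by
      rw [← Real.exp_add]; ring_nf
    rw [h4]
    gcongr
    linarith

/-- A continuous function which is the sum of a series of nonnegative continuous plurisubharmonic
functions is plurisubharmonic. -/
theorem IsContPshOn.of_hasSum {f : ℕ → E → ℝ} {g : E → ℝ} {V : Set E}
    (hf : ∀ n, IsContPshOn (f n) V) (hpos : ∀ n, ∀ y ∈ V, 0 ≤ f n y)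
    (hsum : ∀ y ∈ V, HasSum (fun n => f n y) (g y)) (hg : ContinuousOn g V) :
    IsContPshOn g V := by
  have hpart : ∀ s : Finset ℕ, IsContPshOn (fun y => ∑ n ∈ s, f n y) V := by
    intro s
    induction s using Finset.induction_on with
    | empty => simpa using isContPshOn_const 0 V
    | insert a s ha ih =>
      simp only [Finset.sum_insert ha]
      exact (hf a).add ih
  refine ⟨hg, fun a b h => ?_⟩
  have ha : a ∈ V := by simpa using h 0 (by simp)
  -- Only the value at the centre passes to the limit. Nonnegativity bounds each partial sum by `g`
  -- on the circle, so no limit is exchanged with the integral.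
  refine le_of_tendsto (hsum a ha) (Filter.Eventually.of_forall fun s => ?_)
  refine ((hpart s).2 a b h).trans (Real.circleAverage_mono
    (circleIntegrable_disc (hpart s).1 h) (circleIntegrable_disc hg h) fun ζ hζ => ?_)
  have hV : a + ζ • b ∈ V := h ζ (by simpa using (mem_sphere_zero_iff_norm.1 hζ).le)
  exact sum_le_hasSum s (fun n _ => hpos n _ hV) (hsum _ hV)

end Local


/-! ### Plurisubharmonic functions and `∂φ` on a complex manifold. -/

section Manifold

variable {E : Type*} [NormedAddCommGroup E] [NormedSpace ℂ E]
  {X : Type*} [TopologicalSpace X] [ChartedSpace E X]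

theorem ContPshOn.mono {φ : X → ℝ} {U W : Set X} (hφ : ContPshOn E φ U) (h : W ⊆ U) :
    ContPshOn E φ W :=
  ⟨hφ.1.mono h, fun e he => (hφ.2 e he).mono
    (Set.inter_subset_inter_right _ (Set.preimage_mono h))⟩

theorem contPshOn_const (c : ℝ) (U : Set X) : ContPshOn E (fun _ : X => c) U :=
  ⟨continuousOn_const, fun _ _ => isContPshOn_const c _⟩

theorem ContPshOn.add {φ χ : X → ℝ} {U : Set X} (hφ : ContPshOn E φ U) (hχ : ContPshOn E χ U) :
    ContPshOn E (fun y => φ y + χ y) U :=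
  ⟨hφ.1.add hχ.1, fun e he => (hφ.2 e he).add (hχ.2 e he)⟩

theorem ContPshOn.const_mul {φ : X → ℝ} {U : Set X} {c : ℝ} (hc : 0 ≤ c)
    (hφ : ContPshOn E φ U) : ContPshOn E (fun y => c * φ y) U :=
  ⟨continuousOn_const.mul hφ.1, fun e he => (hφ.2 e he).const_mul hc⟩

theorem ContPshOn.exp {φ : X → ℝ} {U : Set X} (hφ : ContPshOn E φ U) :
    ContPshOn E (fun y => Real.exp (φ y)) U :=
  ⟨hφ.1.rexp, fun e he => (hφ.2 e he).exp⟩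

theorem ContPshOn.sum {ι : Type*} {s : Finset ι} {φ : ι → X → ℝ} {U : Set X}
    (hφ : ∀ i ∈ s, ContPshOn E (φ i) U) : ContPshOn E (fun y => ∑ i ∈ s, φ i y) U := by
  classical
  induction s using Finset.induction_on with
  | empty => simpa using contPshOn_const 0 U
  | insert a s ha ih =>
    simp only [Finset.sum_insert ha]
    exact (hφ a (Finset.mem_insert_self a s)).add
      (ih fun i hi => hφ i (Finset.mem_insert_of_mem hi))

/-- A holomorphic coordinate change is real smooth. -/
theorem contDiffGroupoid_complex_le_real :
    contDiffGroupoid ω 𝓘(ℂ, E) ≤ contDiffGroupoid ∞ 𝓘(ℝ, E) := by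
  intro e he
  change e ∈ contDiffGroupoid ω 𝓘(ℂ, E) at he
  change e ∈ contDiffGroupoid ∞ 𝓘(ℝ, E)
  rw [contDiffGroupoid, mem_groupoid_of_pregroupoid] at he ⊢
  simp only [contDiffPregroupoid, modelWithCornersSelf_coe, modelWithCornersSelf_coe_symm,
    Set.range_id, Set.inter_univ, Set.preimage_id_eq, id_eq, Function.comp_def] at he ⊢
  exact ⟨(he.1.restrict_scalars ℝ).of_le le_top, (he.2.restrict_scalars ℝ).of_le le_top⟩

variable (E X) in
theorem isManifold_real [IsManifold 𝓘(ℂ, E) ω X] : IsManifold 𝓘(ℝ, E) ∞ X where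
  compatible he he' := contDiffGroupoid_complex_le_real
    ((contDiffGroupoid ω 𝓘(ℂ, E)).compatible he he')

theorem mem_maximalAtlas_real {e : OpenPartialHomeomorph X E}
    (he : e ∈ IsManifold.maximalAtlas 𝓘(ℂ, E) ω X) :
    e ∈ IsManifold.maximalAtlas 𝓘(ℝ, E) ∞ X := by
  rw [IsManifold.mem_maximalAtlas_iff, mem_maximalAtlas_iff] at he ⊢
  exact fun e' he' => ⟨contDiffGroupoid_complex_le_real (he e' he').1,
    contDiffGroupoid_complex_le_real (he e' he').2⟩

theorem SmoothOn.mono {φ : X → ℝ} {U W : Set X} (hφ : SmoothOn E φ U) (h : W ⊆ U) :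
    SmoothOn E φ W :=
  ContMDiffOn.mono hφ h

theorem SmoothOn.contDiffAt [IsManifold 𝓘(ℂ, E) ω X] {φ : X → ℝ} {U : Set X}
    (hφ : SmoothOn E φ U) (hU : IsOpen U) {e : OpenPartialHomeomorph X E}
    (he : e ∈ IsManifold.maximalAtlas 𝓘(ℂ, E) ω X) {z : E} (hz : z ∈ e.target)
    (hzU : e.symm z ∈ U) : ContDiffAt ℝ ∞ (φ ∘ e.symm) z := by
  have := isManifold_real E X
  have h1 : ContMDiffAt 𝓘(ℝ, E) 𝓘(ℝ, E) ∞ e.symm z :=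
    (contMDiffOn_symm_of_mem_maximalAtlas (mem_maximalAtlas_real he)).contMDiffAt
      (e.open_target.mem_nhds hz)
  have h2 : ContMDiffAt 𝓘(ℝ, E) 𝓘(ℝ, ℝ) ∞ φ (e.symm z) :=
    ContMDiffOn.contMDiffAt hφ (hU.mem_nhds hzU)
  exact contMDiffAt_iff_contDiffAt.1 (h2.comp z h1)

theorem SmoothOn.exp {φ : X → ℝ} {U : Set X} (hφ : SmoothOn E φ U) :
    SmoothOn E (fun y => Real.exp (φ y)) U :=
  (Real.contDiff_exp.contMDiff (n := ∞)).comp_contMDiffOn hφ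

theorem SmoothOn.sum {ι : Type*} {s : Finset ι} {φ : ι → X → ℝ} {U : Set X}
    (hφ : ∀ i ∈ s, SmoothOn E (φ i) U) : SmoothOn E (fun y => ∑ i ∈ s, φ i y) U :=
  contMDiffOn_finsetSum hφ

theorem SmoothOn.const_mul {φ : X → ℝ} {U : Set X} (hφ : SmoothOn E φ U) (c : ℝ) :
    SmoothOn E (fun y => c * φ y) U :=
  (contDiff_const.mul contDiff_id : ContDiff ℝ ∞ fun t : ℝ => c * t).contMDiff.comp_contMDiffOn
    hφ

theorem mfderiv_eq_fderiv_chartAt {φ : X → ℝ} {y : X}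
    (hφ : MDifferentiableAt 𝓘(ℝ, E) 𝓘(ℝ, ℝ) φ y) :
    (mfderiv 𝓘(ℝ, E) 𝓘(ℝ, ℝ) φ y : E →L[ℝ] ℝ)
      = fderiv ℝ (φ ∘ (chartAt E y).symm) (chartAt E y y) := by
  simp [mfderiv, hφ, writtenInExtChartAt, extChartAt, fderivWithin_univ, Function.comp_def]
  rfl

theorem oneZeroPart_comp (d : E →L[ℝ] ℝ) (A : E →L[ℂ] E) (v : E) :
    oneZeroPart (d.comp (A.restrictScalars ℝ)) v = oneZeroPart d (A v) := by
  simp [oneZeroPart]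

/-- In any holomorphic chart, `∂φ` is read through one and the same complex linear isomorphism
for all functions `φ`. -/
theorem exists_del_eq [FiniteDimensional ℂ E] [IsManifold 𝓘(ℂ, E) ω X]
    {e : OpenPartialHomeomorph X E}
    (he : e ∈ IsManifold.maximalAtlas 𝓘(ℂ, E) ω X) {z : E} (hz : z ∈ e.target) :
    ∃ A : E →L[ℂ] E, Function.Bijective A ∧ ∀ (φ : X → ℝ) (U : Set X), IsOpen U →
      e.symm z ∈ U → SmoothOn E φ U → ∀ v : E,
        oneZeroPart (fderiv ℝ (φ ∘ e.symm) z) v = del E φ (e.symm z) (A v) := by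
  set y := e.symm z with hy
  set c := chartAt E y with hc
  have hcm : c ∈ IsManifold.maximalAtlas 𝓘(ℂ, E) ω X := IsManifold.chart_mem_maximalAtlas y
  have hyc : y ∈ c.source := mem_chart_source E y
  have hye : y ∈ e.source := e.map_target hz
  -- The required isomorphism is the derivative of the transition map to the preferred chart at `y`,
  -- in which `del` is read. The reverse transition map provides a left inverse.
  have hτ : ContDiffAt ℂ ω (c ∘ e.symm) z := by
    have h1 := (contMDiffOn_symm_of_mem_maximalAtlas he).contMDiffAt (e.open_target.mem_nhds hz)
    have h2 := (contMDiffOn_of_mem_maximalAtlas hcm).contMDiffAt (c.open_source.mem_nhds hyc)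
    exact contMDiffAt_iff_contDiffAt.1 (h2.comp z h1)
  have hσ : ContDiffAt ℂ ω (e ∘ c.symm) (c y) := by
    have hcy : c y ∈ c.target := c.map_source hyc
    have h1 := (contMDiffOn_symm_of_mem_maximalAtlas hcm).contMDiffAt
      (c.open_target.mem_nhds hcy)
    have h2 := (contMDiffOn_of_mem_maximalAtlas he).contMDiffAt (e.open_source.mem_nhds hye)
    refine contMDiffAt_iff_contDiffAt.1 (ContMDiffAt.comp (c y) ?_ h1)
    rwa [c.left_inv hyc]
  have hτd := (hτ.differentiableAt (by simp)).hasFDerivAt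
  have hσd := (hσ.differentiableAt (by simp)).hasFDerivAt
  have hnear : ∀ᶠ w in nhds z, w ∈ e.target ∧ e.symm w ∈ c.source :=
    (e.open_target.eventually_mem hz).and
      ((e.continuousAt_symm hz).eventually (c.open_source.mem_nhds hyc))
  have hinv : (fderiv ℂ (e ∘ c.symm) (c y)).comp (fderiv ℂ (c ∘ e.symm) z)
      = ContinuousLinearMap.id ℂ E := by
    refine (HasFDerivAt.comp z (f := c ∘ e.symm) hσd hτd).unique ?_
    refine (hasFDerivAt_id z).congr_of_eventuallyEq ?_
    filter_upwards [hnear] with w hw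
    simp [c.left_inv hw.2, e.right_inv hw.1]
  have hinj : Function.Injective (fderiv ℂ (c ∘ e.symm) z) := by
    refine Function.LeftInverse.injective (g := fderiv ℂ (e ∘ c.symm) (c y)) fun v => ?_
    exact DFunLike.congr_fun hinv v
  refine ⟨fderiv ℂ (c ∘ e.symm) z,
    ⟨hinj, LinearMap.surjective_of_injective (f := (fderiv ℂ (c ∘ e.symm) z).toLinearMap) hinj⟩,
    fun φ U hU hyU hφ v => ?_⟩
  have hφy : ContMDiffAt 𝓘(ℝ, E) 𝓘(ℝ, ℝ) ∞ φ y := ContMDiffOn.contMDiffAt hφ (hU.mem_nhds hyU)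
  have hφc : ContDiffAt ℝ ∞ (φ ∘ c.symm) (c y) :=
    hφ.contDiffAt hU hcm (c.map_source hyc) (by rwa [c.left_inv hyc])
  have hchain : HasFDerivAt (φ ∘ e.symm) ((fderiv ℝ (φ ∘ c.symm) (c y)).comp
      ((fderiv ℂ (c ∘ e.symm) z).restrictScalars ℝ)) z := by
    have := HasFDerivAt.comp z (f := c ∘ e.symm)
      (hφc.differentiableAt (by simp)).hasFDerivAt (hτd.restrictScalars ℝ)
    refine this.congr_of_eventuallyEq ?_
    filter_upwards [hnear] with w hw
    simp [c.left_inv hw.2]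
  rw [hchain.fderiv, oneZeroPart_comp, del,
    mfderiv_eq_fderiv_chartAt (hφy.mdifferentiableAt (by simp))]
  rfl

/-- Needed because `critSet` tests `∂φ` on the chosen representative of a line only. -/
theorem apply_mk_rep_eq_zero {K V : Type*} [Field K] [AddCommGroup V] [Module K V]
    (L : V →ₗ[K] K) {v : V} (hv : v ≠ 0) (h : L v = 0) : L (Projectivization.mk K v hv).rep = 0 := by
  obtain ⟨a, ha⟩ := Projectivization.exists_smul_eq_mk_rep K v hv
  rw [← ha, Units.smul_def, map_smul, h, smul_zero]

/-- A point lies off `π(C(X))` iff the forms `∂φ` have no common zero there. -/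
theorem mem_compl_critCore_iff {x : X} :
    x ∈ Set.univ \ (proj E X '' critCore E X) ↔ ∀ v : E, v ≠ 0 → ∃ φ : X → ℝ,
      ContPshOn E φ Set.univ ∧ (∃ U : Set X, IsOpen U ∧ x ∈ U ∧ SmoothOn E φ U) ∧
        del E φ x v ≠ 0 := by
  simp only [Set.mem_sdiff, Set.mem_univ, true_and, Set.mem_image, not_exists, not_and, critCore,
    Set.mem_iInter, critSet, Set.mem_compl_iff, Set.mem_ofPred_eq]
  constructor
  · intro h v hv
    have h1 := fun hp => h ⟨x, Projectivization.mk ℂ (V := TangentSpace 𝓘(ℂ, E) x) v hv⟩ hp rfl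
    obtain ⟨φ, hφ⟩ := not_forall.1 h1
    simp only [Classical.not_imp, not_not] at hφ
    obtain ⟨hφ, hU, hd⟩ := hφ
    exact ⟨φ, hφ, hU, fun h0 => hd (apply_mk_rep_eq_zero (del E φ x) hv h0)⟩
  · rintro h ⟨x', p⟩ hp rfl
    obtain ⟨φ, hφ, hU, hd⟩ := h p.rep p.rep_nonzero
    exact hp φ hφ hU hd

/-! ### Strict plurisubharmonicity near a point of `Ω`. -/

open Filter Topology in
/-- Finitely many plurisubharmonic functions separate all tangent directions near a point off
`π(C(X))`. -/
theorem exists_finset_del_ne_zero [FiniteDimensional ℂ E] [IsManifold 𝓘(ℂ, E) ω X] {x : X}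
    (hx : x ∈ Set.univ \ (proj E X '' critCore E X)) :
    ∃ (s : Finset (X → ℝ)) (U : Set X), IsOpen U ∧ x ∈ U ∧
      (∀ φ ∈ s, ContPshOn E φ Set.univ ∧ SmoothOn E φ U) ∧
      ∀ y ∈ U, ∀ v : E, v ≠ 0 → ∃ φ ∈ s, del E φ y v ≠ 0 := by
  classical
  rw [mem_compl_critCore_iff] at hx
  set e := chartAt E x with he_def
  have he : e ∈ IsManifold.maximalAtlas 𝓘(ℂ, E) ω X := IsManifold.chart_mem_maximalAtlas x
  have hxe : x ∈ e.source := mem_chart_source E x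
  have : ProperSpace E := FiniteDimensional.proper ℂ E
  -- The argument runs in the fixed chart `e`: the chart that defines `del` changes with the base
  -- point, so continuity in `y` is only visible in `e`.
  obtain ⟨s, U, hU, hxU, hs, hUs⟩ : ∃ (s : Finset (X → ℝ)) (U : Set X), IsOpen U ∧ x ∈ U ∧
      (∀ φ ∈ s, ContPshOn E φ Set.univ ∧ SmoothOn E φ U) ∧
      ∀ y ∈ U, ∀ v ∈ Metric.sphere (0 : E) 1, ∃ φ ∈ s,
        oneZeroPart (fderiv ℝ (φ ∘ e.symm) (e y)) v ≠ 0 := by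
    refine (isCompact_sphere (0 : E) 1).induction_on
      (p := fun S => ∃ (s : Finset (X → ℝ)) (U : Set X), IsOpen U ∧ x ∈ U ∧
      (∀ φ ∈ s, ContPshOn E φ Set.univ ∧ SmoothOn E φ U) ∧
      ∀ y ∈ U, ∀ v ∈ S, ∃ φ ∈ s, oneZeroPart (fderiv ℝ (φ ∘ e.symm) (e y)) v ≠ 0) ?_ ?_ ?_ ?_
    · exact ⟨∅, Set.univ, isOpen_univ, trivial, by simp, by simp⟩
    · rintro S T hST ⟨s, U, hU, hxU, hs, h⟩
      exact ⟨s, U, hU, hxU, hs, fun y hy v hv => h y hy v (hST hv)⟩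
    · rintro S T ⟨s, U, hU, hxU, hs, hS⟩ ⟨t, W, hW, hxW, ht, hT⟩
      refine ⟨s ∪ t, U ∩ W, hU.inter hW, ⟨hxU, hxW⟩, fun φ hφ => ?_, fun y hy v hv => ?_⟩
      · rcases Finset.mem_union.1 hφ with hφ | hφ
        · exact ⟨(hs φ hφ).1, (hs φ hφ).2.mono Set.inter_subset_left⟩
        · exact ⟨(ht φ hφ).1, (ht φ hφ).2.mono Set.inter_subset_right⟩
      · rcases hv with hv | hv
        · obtain ⟨φ, hφ, h⟩ := hS y hy.1 v hv
          exact ⟨φ, Finset.mem_union_left _ hφ, h⟩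
        · obtain ⟨φ, hφ, h⟩ := hT y hy.2 v hv
          exact ⟨φ, Finset.mem_union_right _ hφ, h⟩
    · intro v hv
      have hv0 : v ≠ 0 := ne_zero_of_mem_unit_sphere ⟨v, hv⟩
      obtain ⟨A, hA, hdel⟩ := exists_del_eq he (e.map_source hxe)
      rw [e.left_inv hxe] at hdel
      obtain ⟨φ, hφ, ⟨U, hU, hxU, hφU⟩, hne⟩ := hx (A v)
        (fun h => hv0 (hA.1 (h.trans (map_zero A).symm)))
      have hcd : ContDiffAt ℝ ∞ (φ ∘ e.symm) (e x) :=
        hφU.contDiffAt hU he (e.map_source hxe) (by rwa [e.left_inv hxe])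
      have hfd : ContinuousAt (fderiv ℝ (φ ∘ e.symm)) (e x) :=
        (hcd.fderiv_right (m := 0) (by simp)).continuousAt
      have hfd' : ContinuousAt (fun p : X × E => fderiv ℝ (φ ∘ e.symm) (e p.1)) (x, v) :=
        ContinuousAt.comp (f := fun p : X × E => e p.1) (x := (x, v)) hfd
          ((e.continuousAt hxe).comp continuousAt_fst)
      have hcont : ContinuousAt
          (fun p : X × E => oneZeroPart (fderiv ℝ (φ ∘ e.symm) (e p.1)) p.2) (x, v) := by
        simp only [oneZeroPart, LinearMap.coe_mk, AddHom.coe_mk]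
        have h1 : ContinuousAt (fun p : X × E => fderiv ℝ (φ ∘ e.symm) (e p.1) p.2) (x, v) :=
          hfd'.clm_apply continuousAt_snd
        have h2 : ContinuousAt
            (fun p : X × E => fderiv ℝ (φ ∘ e.symm) (e p.1) (Complex.I • p.2)) (x, v) :=
          hfd'.clm_apply (continuousAt_snd.const_smul _)
        exact ((Complex.continuous_ofReal.continuousAt.comp h1).sub (continuousAt_const.mul
          (Complex.continuous_ofReal.continuousAt.comp h2))).div_const _
      have hev := hcont.eventually_ne (y := 0) (by rwa [hdel φ U hU hxU hφU v])
      rw [nhds_prod_eq, eventually_prod_iff] at hev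
      obtain ⟨pa, hpa, pb, hpb, hp⟩ := hev
      obtain ⟨W, hWpa, hW, hxW⟩ := eventually_nhds_iff.1 hpa
      refine ⟨{w | pb w}, mem_nhdsWithin_of_mem_nhds hpb, {φ}, U ∩ W, hU.inter hW, ⟨hxU, hxW⟩,
        ?_, fun y hy w hw => ⟨φ, by simp, hp (hWpa y hy.2) hw⟩⟩
      simpa using ⟨hφ, hφU.mono Set.inter_subset_left⟩
  refine ⟨s, U ∩ e.source, hU.inter e.open_source, ⟨hxU, hxe⟩,
    fun φ hφ => ⟨(hs φ hφ).1, (hs φ hφ).2.mono Set.inter_subset_left⟩, fun y hy v hv => ?_⟩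
  -- Back from `e` to `del` at `y`: a direction is `A w`, and `w` is rescaled to the unit sphere.
  obtain ⟨A, hA, hdel⟩ := exists_del_eq he (e.map_source hy.2)
  rw [e.left_inv hy.2] at hdel
  obtain ⟨w, rfl⟩ := hA.2 v
  have hw : w ≠ 0 := fun h => hv (by rw [h, map_zero])
  obtain ⟨φ, hφ, h⟩ := hUs y hy.1 ((‖w‖⁻¹ : ℂ) • w) (by
    simp [norm_smul, norm_ne_zero_iff.2 hw])
  refine ⟨φ, hφ, fun h0 => h ?_⟩
  rw [map_smul, hdel φ U hU hy.1 (hs φ hφ).2 w, h0, smul_zero]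

/-- If the forms `∂φ` of finitely many smooth plurisubharmonic functions have no common zero, then
the sum of the functions `exp φ` is strictly plurisubharmonic. -/
theorem smoothStrictPshOn_sum_exp [FiniteDimensional ℂ E] [IsManifold 𝓘(ℂ, E) ω X]
    {s : Finset (X → ℝ)} {U : Set X} (hU : IsOpen U)
    (hs : ∀ φ ∈ s, ContPshOn E φ U ∧ SmoothOn E φ U)
    (hdel : ∀ y ∈ U, ∀ v : E, v ≠ 0 → ∃ φ ∈ s, del E φ y v ≠ 0) :
    SmoothStrictPshOn E (fun y => ∑ φ ∈ s, Real.exp (φ y)) U := by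
  refine ⟨SmoothOn.sum fun φ hφ => (hs φ hφ).2.exp, fun e he z hz v hv => ?_⟩
  have hcd : ∀ φ ∈ s, ContDiffAt ℝ 2 (φ ∘ e.symm) z := fun φ hφ =>
    ((hs φ hφ).2.contDiffAt hU he hz.1 hz.2).of_le (by norm_cast)
  have hopen : IsOpen (e.target ∩ e.symm ⁻¹' U) := e.isOpen_inter_preimage_symm hU
  have hterm : ∀ φ ∈ s, leviForm (fun y => Real.exp ((φ ∘ e.symm) y)) z v
      = Real.exp ((φ ∘ e.symm) z) * (leviForm (φ ∘ e.symm) z v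
        + ((fderiv ℝ (φ ∘ e.symm) z v) ^ 2
          + (fderiv ℝ (φ ∘ e.symm) z (Complex.I • v)) ^ 2) / 4) :=
    fun φ hφ => leviForm_exp (hcd φ hφ) v
  have hlevi : ∀ φ ∈ s, 0 ≤ leviForm (φ ∘ e.symm) z v := fun φ hφ =>
    ((hs φ hφ).1.2 e he).leviForm_nonneg hopen hz (hcd φ hφ) v
  have hsum := leviForm_sum (f := fun (φ : X → ℝ) y => Real.exp ((φ ∘ e.symm) y))
    (fun φ hφ => (hcd φ hφ).exp) v
  refine lt_of_lt_of_eq ?_ hsum.symm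
  obtain ⟨A, hA, hdelA⟩ := exists_del_eq he hz.1
  obtain ⟨φ, hφ, hne⟩ := hdel (e.symm z) hz.2 (A v)
    (fun h => hv (hA.1 (h.trans (map_zero A).symm)))
  rw [← hdelA φ U hU hz.2 (hs φ hφ).2 v, Ne, oneZeroPart_eq_zero_iff, not_and_or] at hne
  refine Finset.sum_pos' (fun χ hχ => ?_) ⟨φ, hφ, ?_⟩
  · rw [hterm χ hχ]
    have := hlevi χ hχ
    positivity
  · rw [hterm φ hφ]
    have := hlevi φ hφ
    have : 0 < (fderiv ℝ (φ ∘ e.symm) z v) ^ 2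
        + (fderiv ℝ (φ ∘ e.symm) z (Complex.I • v)) ^ 2 := by
      rcases hne with h | h
      · have := sq_pos_of_ne_zero h
        positivity
      · have := sq_pos_of_ne_zero h
        positivity
    positivity

/-! ### Gluing by a weighted series. -/

theorem SmoothStrictPshOn.const_mul {φ : X → ℝ} {U : Set X} {c : ℝ} (hc : 0 < c)
    (hφ : SmoothStrictPshOn E φ U) : SmoothStrictPshOn E (fun y => c * φ y) U :=
  ⟨hφ.1.const_mul c, fun e he z hz v hv =>
    (mul_pos hc (hφ.2 e he z hz v hv)).trans_eq (leviForm_const_mul c z v).symm⟩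

/-- A locally normally convergent series of nonnegative continuous plurisubharmonic functions. -/
theorem contPshOn_tsum
    (K : CompactExhaustion X) {g : ℕ → X → ℝ} (hg : ∀ n, ContPshOn E (g n) Set.univ)
    (hpos : ∀ n x, 0 ≤ g n x) (hbound : ∀ n, ∀ x ∈ K n, g n x ≤ (1 / 2) ^ n) :
    (∀ x, Summable fun n => g n x) ∧ ContPshOn E (fun x => ∑' n, g n x) Set.univ := by
  -- On `K N` the bounds hold only from index `N` on, so the tail is shifted by `N` and the first
  -- `N` terms are treated as a finite sum.
  have hb : ∀ N, ∀ x ∈ K N, ∀ n, g (n + N) x ≤ (1 / 2) ^ n := fun N x hx n =>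
    (hbound (n + N) x (K.subset (Nat.le_add_left _ _) hx)).trans
      (pow_le_pow_of_le_one (by norm_num) (by norm_num) (Nat.le_add_right _ _))
  have hgeo : Summable fun n : ℕ => ((1 : ℝ) / 2) ^ n := summable_geometric_two
  have hsummable : ∀ x, Summable fun n => g n x := by
    intro x
    obtain ⟨N, hN⟩ := K.exists_mem x
    exact (summable_nat_add_iff N).1
      (hgeo.of_nonneg_of_le (fun n => hpos _ _) (fun n => hb N x hN n))
  have hcont : Continuous fun x => ∑' n, g n x := by
    rw [continuous_iff_continuousAt]
    intro x
    obtain ⟨N, hN⟩ := K.exists_mem_nhds x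
    have h1 : ContinuousOn (fun x => ∑' n, g (n + N) x) (K N) := by
      refine continuousOn_tsum (fun n => (hg _).1.mono (Set.subset_univ _)) hgeo
        fun n y hy => ?_
      rw [Real.norm_of_nonneg (hpos _ _)]
      exact hb N y hy n
    have h2 : ContinuousAt (fun x => ∑ n ∈ Finset.range N, g n x) x :=
      (continuous_finsetSum _ fun n _ => continuousOn_univ.1 (hg n).1).continuousAt
    exact (h2.add (h1.continuousAt hN)).congr
      (Filter.Eventually.of_forall fun y => (hsummable y).sum_add_tsum_nat_add N)
  refine ⟨hsummable, hcont.continuousOn, fun e he => ?_⟩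
  exact IsContPshOn.of_hasSum (f := fun n => g n ∘ e.symm) (fun n => (hg n).2 e he)
    (fun n y _ => hpos n _) (fun y _ => (hsummable _).hasSum)
    (hcont.comp_continuousOn (e.continuousOn_symm.mono Set.inter_subset_left))

end Manifold

end ComplexMfd

theorem lemma2p2 {E : Type*} [NormedAddCommGroup E] [NormedSpace ℂ E] [FiniteDimensional ℂ E]
    {X : Type*} [TopologicalSpace X] [T2Space X] [SecondCountableTopology X]
    [ChartedSpace E X] [IsManifold 𝓘(ℂ, E) ω X] :
    ∃ ψ : X → ℝ, ComplexMfd.ContPshOn E ψ Set.univ ∧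
      ComplexMfd.StrictPshOn E ψ
        (Set.univ \ (ComplexMfd.proj E X '' ComplexMfd.critCore E X)) := by
  open ComplexMfd in
  classical
  have : ProperSpace E := FiniteDimensional.proper ℂ E
  have : LocallyCompactSpace X := ChartedSpace.locallyCompactSpace E X
  set Ω : Set X := Set.univ \ (proj E X '' critCore E X) with hΩ
  let P : Set X × (X → ℝ) → Prop := fun p => IsOpen p.1 ∧ p.1 ⊆ Ω ∧
    ContPshOn E p.2 Set.univ ∧ (∀ x, 0 ≤ p.2 x) ∧ SmoothStrictPshOn E p.2 p.1
  have hlocal : ∀ x ∈ Ω, ∃ p, P p ∧ x ∈ p.1 := by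
    intro x hx
    obtain ⟨s, U, hU, hxU, hs, hdel⟩ := exists_finset_del_ne_zero hx
    refine ⟨(U, fun y => ∑ φ ∈ s, Real.exp (φ y)), ⟨hU, fun y hy => ?_,
      ContPshOn.sum fun φ hφ => (hs φ hφ).1.exp,
      fun y => Finset.sum_nonneg fun φ _ => (Real.exp_pos _).le,
      smoothStrictPshOn_sum_exp hU
        (fun φ hφ => ⟨(hs φ hφ).1.mono (Set.subset_univ _), (hs φ hφ).2⟩) hdel⟩, hxU⟩
    refine mem_compl_critCore_iff.2 fun v hv => ?_
    obtain ⟨φ, hφ, hne⟩ := hdel y hy v hv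
    exact ⟨φ, (hs φ hφ).1, ⟨U, hU, hy, (hs φ hφ).2⟩, hne⟩
  -- The trivial pair makes the countable family nonempty, so that it can be enumerated by `ℕ` even
  -- if `Ω` is empty.
  have hempty : P (∅, fun _ => 0) := by
    refine ⟨isOpen_empty, Set.empty_subset _, contPshOn_const 0 _, fun _ => le_rfl, ?_, ?_⟩
    · exact contMDiffOn_const
    · rintro e _ z ⟨_, hz⟩
      exact hz.elim
  -- Second countability, in its Lindelöf form, selects a countable subfamily with the same union.
  obtain ⟨T, hT, hTU⟩ := TopologicalSpace.isOpen_iUnion_countable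
    (fun p : {p // P p} => p.1.1) fun p => p.2.1
  obtain ⟨p, hp⟩ := (hT.insert ⟨_, hempty⟩).exists_eq_range (Set.insert_nonempty _ _)
  have hcover : ∀ x ∈ Ω, ∃ n, x ∈ (p n).1.1 := by
    intro x hx
    obtain ⟨q, hq, hxq⟩ := hlocal x hx
    have : x ∈ ⋃ i ∈ T, (fun p : {p // P p} => p.1.1) i := by
      rw [hTU]
      exact Set.mem_iUnion.2 ⟨⟨q, hq⟩, hxq⟩
    obtain ⟨i, hi, hxi⟩ := Set.mem_iUnion₂.1 this
    obtain ⟨n, hn⟩ := hp ▸ Set.mem_insert_of_mem _ hi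
    exact ⟨n, hn ▸ hxi⟩
  let K : CompactExhaustion X := default
  have hc : ∀ n, ∃ c : ℝ, 0 < c ∧ ∀ x ∈ K n, c * (p n).1.2 x ≤ (1 / 2) ^ n := by
    intro n
    obtain ⟨M, hM⟩ := (K.isCompact n).bddAbove_image
      ((p n).2.2.2.1.1.mono (Set.subset_univ _))
    -- `M` bounds the `n`-th function on the compact set `K n`; `|M| + 1` is a positive bound.
    refine ⟨(1 / 2) ^ n / (|M| + 1), by positivity, fun x hx => ?_⟩
    rw [div_mul_eq_mul_div, div_le_iff₀ (by positivity)]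
    have := hM (Set.mem_image_of_mem _ hx)
    gcongr
    linarith [le_abs_self M]
  choose c hc0 hcK using hc
  let g : ℕ → X → ℝ := fun n x => c n * (p n).1.2 x
  have hg : ∀ n, ContPshOn E (g n) Set.univ := fun n => (p n).2.2.2.1.const_mul (hc0 n).le
  have hg0 : ∀ n x, 0 ≤ g n x := fun n x => mul_nonneg (hc0 n).le ((p n).2.2.2.2.1 x)
  obtain ⟨hsum, hψ⟩ := contPshOn_tsum K hg hg0 hcK
  refine ⟨_, hψ, hψ.1.mono (Set.subset_univ _), fun x hx => ?_⟩
  obtain ⟨k, hk⟩ := hcover x hx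
  -- Replacing the `k`-th term by zero keeps nonnegativity and all the bounds, so the rest of the
  -- series is plurisubharmonic by the same lemma.
  have hrest := contPshOn_tsum K (E := E) (g := fun n x => if n = k then 0 else g n x)
    (fun n => ?_) (fun n x => ?_) (fun n x hx => ?_)
  · exact ⟨(p k).1.1, (p k).2.1, hk, (p k).2.2.1, _, _, hrest.2.mono (Set.subset_univ _),
      (p k).2.2.2.2.2.const_mul (hc0 k),
      fun y _ => ((hsum y).tsum_eq_add_tsum_ite k).trans (add_comm _ _)⟩
  · by_cases h : n = k
    · simpa [h] using contPshOn_const 0 _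
    · simpa [h] using hg n
  · split_ifs
    exacts [le_rfl, hg0 n x]
  · split_ifs
    exacts [by positivity, hcK n x hx]
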